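/- An MV-algebra is an algebra $(A,\oplus,\neg,\bot)$ such that $(A,\oplus,\bot)$ is a commutative monoid, $\neg\neg x=x$, $x\oplus\neg\bot=\neg\bot$ and $\neg(\neg x\oplus y)\oplus y=\neg(\neg y\oplus x)\oplus x$; put $x\to y:=\neg x\oplus y$. Let $k\ge 0$ be an integer and let $\mathrm{Free}(k)$ be the free MV-algebra on $k$ generators $x_1,\dots,x_k$. Each $a\in\mathrm{Free}(k)$ induces a function $a:[0,1]^k\to[0,1]$, obtained by evaluating at points of the cube in the standard MV-algebra $[0,1]$ ($x\oplus y=\min\{1,x+y\}$, $\neg x=1-x$, $\bot=0$); let $O(a)=\{x\in[0,1]^k : a(x)=1\}$. A rational polyhedron is a finite (possibly empty) union of convex hulls of finite sets of points of $\mathbb{Q}^k$. For a set $P\subseteq[0,1]^k$ let $F_P=\{a\in\mathrm{Free}(k): P\subseteq O(a)\}$, let $\theta_P=\{(a,b): a\to b\in F_P \text{ and } b\to a\in F_P\}$ be the associated congruence of $\mathrm{Free}(k)$, write $\mathrm{Free}(k)/P$ for $\mathrm{Free}(k)/\theta_P$, and write $[a]_P$ for the class of $a$. (1) Let $P,Q\subseteq[0,1]^k$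 be rational polyhedra, and let $S\subseteq\mathrm{Free}(k)\times\mathrm{Free}(k)$ be any set of pairs that generates the congruence $\theta_Q$. Let $\hat\theta_Q$ be the congruence of $\mathrm{Free}(k)/P$ generated by the pairs $([a]_P,[b]_P)$ with $(a,b)\in S$. Then $$(\mathrm{Free}(k)/P)/\hat\theta_Q\;\cong\;\mathrm{Free}(k)/(P\cap Q),$$ via an isomorphism that sends $[[a]_P]_{\hat\theta_Q}$ to $[a]_{P\cap Q}$ for every $a\in\mathrm{Free}(k)$. (2) Call an MV-algebra finitely presented if it is isomorphic to the quotient of a free MV-algebra on finitely many generators by a finitely generated congruence. If $A$ is a finitely presented MV-algebra and $\theta$ is a finitely generated congruence of $A$, then $A/\theta$ is finitely presented. -/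

import Mathlib

universe u v

/-- MV-algebras `(A, ⊕, ¬, 0)`: a commutative monoid with an involution satisfying `x ⊕ ¬0 = ¬0`
and Łukasiewicz's identity. -/
class MVAlgebra (A : Type u) where
  oplus : A → A → A
  neg : A → A
  bot : A
  oplus_assoc : ∀ x y z, oplus (oplus x y) z = oplus x (oplus y z)
  oplus_comm : ∀ x y, oplus x y = oplus y x
  oplus_bot : ∀ x, oplus x bot = x
  neg_neg : ∀ x, neg (neg x) = x
  oplus_neg_bot : ∀ x, oplus x (neg bot) = neg bot
  lukasiewicz : ∀ x y, oplus (neg (oplus (neg x) y)) y = oplus (neg (oplus (neg y) x)) x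

namespace MVAlgebra

/-- The top element `⊤ = ¬⊥`. -/
def top (A : Type u) [MVAlgebra A] : A := neg bot

/-- The implication `x → y = ¬x ⊕ y`. -/
def imp {A : Type u} [MVAlgebra A] (x y : A) : A := oplus (neg x) y

end MVAlgebra

open MVAlgebra in
/-- Homomorphisms of MV-algebras. -/
structure MVHom (A : Type u) (B : Type v) [MVAlgebra A] [MVAlgebra B] where
  toFun : A → B
  map_oplus : ∀ x y, toFun (oplus x y) = oplus (toFun x) (toFun y)
  map_neg : ∀ x, toFun (neg x) = neg (toFun x)
  map_bot : toFun bot = bot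

open MVAlgebra in
/-- Isomorphisms of MV-algebras. -/
structure MVEquiv (A : Type u) (B : Type v) [MVAlgebra A] [MVAlgebra B] extends A ≃ B where
  map_oplus : ∀ x y, toFun (oplus x y) = oplus (toFun x) (toFun y)
  map_neg : ∀ x, toFun (neg x) = neg (toFun x)
  map_bot : toFun bot = bot

open MVAlgebra in
/-- Congruences of an MV-algebra. -/
@[ext]
structure MVCon (A : Type u) [MVAlgebra A] where
  r : A → A → Prop
  iseqv : Equivalence r
  oplus : ∀ {a b c d}, r a b → r c d → r (oplus a c) (oplus b d)
  neg : ∀ {a b}, r a b → r (neg a) (neg b)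

namespace MVCon

variable {A : Type u} [MVAlgebra A]

/-- The underlying set of the quotient algebra `A / θ`. -/
def Quot (θ : MVCon A) : Type u := Quotient (Setoid.mk θ.r θ.iseqv)

/-- The class `[a]` of `a` in `A / θ`. -/
def cls (θ : MVCon A) (a : A) : θ.Quot := Quotient.mk (Setoid.mk θ.r θ.iseqv) a

/-- The quotient MV-algebra `A / θ`. -/
instance (θ : MVCon A) : MVAlgebra θ.Quot where
  oplus := Quotient.map₂ MVAlgebra.oplus (fun _ _ h _ _ h' => θ.oplus h h')
  neg := Quotient.map MVAlgebra.neg (fun _ _ h => θ.neg h)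
  bot := θ.cls MVAlgebra.bot
  oplus_assoc := by
    rintro ⟨x⟩ ⟨y⟩ ⟨z⟩
    exact congrArg θ.cls (MVAlgebra.oplus_assoc x y z)
  oplus_comm := by
    rintro ⟨x⟩ ⟨y⟩
    exact congrArg θ.cls (MVAlgebra.oplus_comm x y)
  oplus_bot := by
    rintro ⟨x⟩
    exact congrArg θ.cls (MVAlgebra.oplus_bot x)
  neg_neg := by
    rintro ⟨x⟩
    exact congrArg θ.cls (MVAlgebra.neg_neg x)
  oplus_neg_bot := by
    rintro ⟨x⟩
    exact congrArg θ.cls (MVAlgebra.oplus_neg_bot x)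
  lukasiewicz := by
    rintro ⟨x⟩ ⟨y⟩
    exact congrArg θ.cls (MVAlgebra.lukasiewicz x y)

/-- The congruence generated by a set of pairs: the smallest congruence containing it. -/
def gen (S : Set (A × A)) : MVCon A where
  r a b := ∀ θ : MVCon A, (∀ p ∈ S, θ.r p.1 p.2) → θ.r a b
  iseqv :=
    { refl := fun a θ _ => θ.iseqv.refl a
      symm := fun h θ hθ => θ.iseqv.symm (h θ hθ)
      trans := fun h h' θ hθ => θ.iseqv.trans (h θ hθ) (h' θ hθ) }
  oplus h h' θ hθ := θ.oplus (h θ hθ) (h' θ hθ)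
  neg h θ hθ := θ.neg (h θ hθ)

/-- Finitely generated congruences. -/
def IsFG (θ : MVCon A) : Prop := ∃ S : Set (A × A), S.Finite ∧ gen S = θ

end MVCon

/-- Terms in the language `(⊕, ¬, ⊥)` with variables in `X`. -/
inductive MVTerm (X : Type u) : Type u
  | var : X → MVTerm X
  | bot : MVTerm X
  | neg : MVTerm X → MVTerm X
  | oplus : MVTerm X → MVTerm X → MVTerm X

namespace MVTerm

variable {X : Type u}

/-- Provable equality of terms from the MV-algebra identities (equational logic). -/
inductive Eqv : MVTerm X → MVTerm X → Prop
  | refl (s) : Eqv s s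
  | symm {s t} : Eqv s t → Eqv t s
  | trans {s t w} : Eqv s t → Eqv t w → Eqv s w
  | congr_oplus {s s' t t'} : Eqv s s' → Eqv t t' → Eqv (oplus s t) (oplus s' t')
  | congr_neg {s s'} : Eqv s s' → Eqv (neg s) (neg s')
  | oplus_assoc (s t w) : Eqv (oplus (oplus s t) w) (oplus s (oplus t w))
  | oplus_comm (s t) : Eqv (oplus s t) (oplus t s)
  | oplus_bot (s) : Eqv (oplus s bot) s
  | neg_neg (s) : Eqv (neg (neg s)) s
  | oplus_neg_bot (s) : Eqv (oplus s (neg bot)) (neg bot)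
  | lukasiewicz (s t) :
      Eqv (oplus (neg (oplus (neg s) t)) t) (oplus (neg (oplus (neg t) s)) s)

/-- The value of a term in an MV-algebra under a valuation of the variables. -/
def val {A : Type v} [MVAlgebra A] (f : X → A) : MVTerm X → A
  | var x => f x
  | bot => MVAlgebra.bot
  | neg s => MVAlgebra.neg (val f s)
  | oplus s t => MVAlgebra.oplus (val f s) (val f t)

theorem Eqv.val_eq {A : Type v} [MVAlgebra A] (f : X → A) {s t : MVTerm X} (h : Eqv s t) :
    s.val f = t.val f := by
  induction h with
  | refl s => rfl
  | symm _ ih => exact ih.symm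
  | trans _ _ ih ih' => exact ih.trans ih'
  | congr_oplus _ _ ih ih' => simp only [val, ih, ih']
  | congr_neg _ ih => simp only [val, ih]
  | oplus_assoc s t w => exact MVAlgebra.oplus_assoc _ _ _
  | oplus_comm s t => exact MVAlgebra.oplus_comm _ _
  | oplus_bot s => exact MVAlgebra.oplus_bot _
  | neg_neg s => exact MVAlgebra.neg_neg _
  | oplus_neg_bot s => exact MVAlgebra.oplus_neg_bot _
  | lukasiewicz s t => exact MVAlgebra.lukasiewicz _ _

/-- Provable equality as a setoid. -/
def setoid (X : Type u) : Setoid (MVTerm X) := ⟨Eqv, ⟨Eqv.refl, Eqv.symm, Eqv.trans⟩⟩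

end MVTerm

/-- The MV-algebra `Free(X)` freely generated by `X`. -/
def FreeMV (X : Type u) : Type u := Quotient (MVTerm.setoid X)

namespace FreeMV

variable {X : Type u}

/-- The class of a term. -/
def mk (s : MVTerm X) : FreeMV X := Quotient.mk (MVTerm.setoid X) s

theorem sound {s t : MVTerm X} (h : MVTerm.Eqv s t) : mk s = mk t := Quotient.sound h

instance : MVAlgebra (FreeMV X) where
  oplus := Quotient.map₂ MVTerm.oplus (fun _ _ h _ _ h' => MVTerm.Eqv.congr_oplus h h')
  neg := Quotient.map MVTerm.neg (fun _ _ h => MVTerm.Eqv.congr_neg h)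
  bot := mk MVTerm.bot
  oplus_assoc := by
    rintro ⟨x⟩ ⟨y⟩ ⟨z⟩
    exact sound (.oplus_assoc x y z)
  oplus_comm := by
    rintro ⟨x⟩ ⟨y⟩
    exact sound (.oplus_comm x y)
  oplus_bot := by
    rintro ⟨x⟩
    exact sound (.oplus_bot x)
  neg_neg := by
    rintro ⟨x⟩
    exact sound (.neg_neg x)
  oplus_neg_bot := by
    rintro ⟨x⟩
    exact sound (.oplus_neg_bot x)
  lukasiewicz := by
    rintro ⟨x⟩ ⟨y⟩
    exact sound (.lukasiewicz x y)

/-- The free generators. -/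
def of (x : X) : FreeMV X := mk (MVTerm.var x)

/-- The homomorphism `Free(X) → A` extending `f : X → A`. -/
def lift {A : Type v} [MVAlgebra A] (f : X → A) : MVHom (FreeMV X) A where
  toFun := Quotient.lift (MVTerm.val f) (fun _ _ h => MVTerm.Eqv.val_eq f h)
  map_oplus := by
    rintro ⟨x⟩ ⟨y⟩
    rfl
  map_neg := by
    rintro ⟨x⟩
    rfl
  map_bot := rfl

/-- The universal property of the free MV-algebra. -/
theorem lift_unique {A : Type v} [MVAlgebra A] (f : X → A) (h : MVHom (FreeMV X) A) :
    (∀ x, h.toFun (of x) = f x) ↔ h.toFun = (lift f).toFun := by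
  constructor
  · intro hf
    funext a
    obtain ⟨s⟩ := a
    change h.toFun (mk s) = s.val f
    induction s with
    | var x => exact hf x
    | bot => exact h.map_bot
    | neg s ih => exact (h.map_neg (mk s)).trans (congrArg _ ih)
    | oplus s t ih ih' => exact (h.map_oplus (mk s) (mk t)).trans (congrArg₂ _ ih ih')
  · intro hf x
    rw [hf]
    rfl

end FreeMV

/-- An MV-algebra is finitely presented if it is isomorphic to the quotient of a finitely generated
free MV-algebra by a finitely generated congruence. -/
def IsFinitelyPresentedMV (A : Type u) [MVAlgebra A] : Prop :=
  ∃ (k : ℕ) (θ : MVCon (FreeMV (Fin k))), θ.IsFG ∧ Nonempty (MVEquiv A θ.Quot)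

/-- The standard MV-algebra on `[0,1]`: `x ⊕ y = min 1 (x + y)` and `¬x = 1 - x`. -/
noncomputable instance : MVAlgebra unitInterval where
  oplus x y := ⟨min 1 (x + y), le_min zero_le_one (add_nonneg x.2.1 y.2.1), min_le_left _ _⟩
  neg x := ⟨1 - x, sub_nonneg.2 x.2.2, sub_le_self _ x.2.1⟩
  bot := 0
  oplus_assoc := by
    rintro ⟨x, hx0, hx1⟩ ⟨y, hy0, hy1⟩ ⟨z, hz0, hz1⟩
    apply Subtype.ext
    simp only
    grind
  oplus_comm := by
    rintro ⟨x, hx0, hx1⟩ ⟨y, hy0, hy1⟩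
    apply Subtype.ext
    simp only
    grind
  oplus_bot := by
    rintro ⟨x, hx0, hx1⟩
    apply Subtype.ext
    simp [hx1]
  neg_neg := by
    rintro ⟨x, hx0, hx1⟩
    apply Subtype.ext
    simp
  oplus_neg_bot := by
    rintro ⟨x, hx0, hx1⟩
    apply Subtype.ext
    simp [hx0]
  lukasiewicz := by
    rintro ⟨x, hx0, hx1⟩ ⟨y, hy0, hy1⟩
    apply Subtype.ext
    simp only
    grind

theorem unitInterval.imp_eq_top_iff (x y : unitInterval) :
    MVAlgebra.imp x y = MVAlgebra.top unitInterval ↔ x ≤ y := by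
  obtain ⟨x, hx0, hx1⟩ := x
  obtain ⟨y, hy0, hy1⟩ := y
  rw [Subtype.ext_iff]
  change min 1 (1 - x + y) = 1 - (0 : ℝ) ↔ x ≤ y
  grind

/-- The function `[0,1]^k → [0,1]` represented by an element of `Free(k)`. -/
noncomputable def evalAt {k : ℕ} (a : FreeMV (Fin k)) (x : Fin k → unitInterval) : unitInterval :=
  (FreeMV.lift x).toFun a

/-- The oneset `O(a) = {x ∈ [0,1]^k | a(x) = 1}`. -/
def oneset {k : ℕ} (a : FreeMV (Fin k)) : Set (Fin k → unitInterval) := {x | evalAt a x = 1}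

/-- The filter `F_P = {a ∈ Free(k) | P ⊆ O(a)}` of a subset `P` of the cube. -/
def polyFilter {k : ℕ} (P : Set (Fin k → unitInterval)) : Set (FreeMV (Fin k)) :=
  {a | P ⊆ oneset a}

theorem imp_mem_polyFilter_iff {k : ℕ} (P : Set (Fin k → unitInterval)) (a b : FreeMV (Fin k)) :
    MVAlgebra.imp a b ∈ polyFilter P ↔ ∀ x ∈ P, evalAt a x ≤ evalAt b x := by
  have h1 : MVAlgebra.top unitInterval = 1 := by
    apply Subtype.ext
    simp [MVAlgebra.top, MVAlgebra.neg, MVAlgebra.bot]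
  refine forall₂_congr fun x _ => ?_
  rw [← unitInterval.imp_eq_top_iff, h1]
  change evalAt _ x = 1 ↔ _
  rw [evalAt, MVAlgebra.imp, (FreeMV.lift x).map_oplus, (FreeMV.lift x).map_neg]
  rfl

theorem polyFilter_iff {k : ℕ} (P : Set (Fin k → unitInterval)) (a b : FreeMV (Fin k)) :
    (MVAlgebra.imp a b ∈ polyFilter P ∧ MVAlgebra.imp b a ∈ polyFilter P) ↔
      ∀ x ∈ P, evalAt a x = evalAt b x := by
  rw [imp_mem_polyFilter_iff, imp_mem_polyFilter_iff]
  exact ⟨fun h x hx => le_antisymm (h.1 x hx) (h.2 x hx),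
    fun h => ⟨fun x hx => (h x hx).le, fun x hx => (h x hx).ge⟩⟩

/-- The congruence of `Free(k)` associated to `P ⊆ [0,1]^k`: the pairs `(a, b)` such that `a → b`
and `b → a` both lie in the filter `F_P`. -/
def polyCon {k : ℕ} (P : Set (Fin k → unitInterval)) : MVCon (FreeMV (Fin k)) where
  r a b := MVAlgebra.imp a b ∈ polyFilter P ∧ MVAlgebra.imp b a ∈ polyFilter P
  iseqv := by
    simp only [polyFilter_iff]
    exact ⟨fun _ _ _ => rfl, fun h x hx => (h x hx).symm,
      fun h h' x hx => (h x hx).trans (h' x hx)⟩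
  oplus := by
    simp only [polyFilter_iff]
    intro a b c d h h' x hx
    have e := h x hx
    have e' := h' x hx
    simp only [evalAt] at e e' ⊢
    rw [(FreeMV.lift x).map_oplus, (FreeMV.lift x).map_oplus, e, e']
  neg := by
    simp only [polyFilter_iff]
    intro a b h x hx
    have e := h x hx
    simp only [evalAt] at e ⊢
    rw [(FreeMV.lift x).map_neg, (FreeMV.lift x).map_neg, e]

/-- The algebra `Free(k) / P`. -/
abbrev FreeModPoly (k : ℕ) (P : Set (Fin k → unitInterval)) : Type := (polyCon P).Quot

/-- The class `[a]_P` of `a ∈ Free(k)` in `Free(k) / P`. -/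
abbrev polyClass {k : ℕ} (P : Set (Fin k → unitInterval)) (a : FreeMV (Fin k)) :
    FreeModPoly k P := (polyCon P).cls a

/-- The rational polytope spanned by a finite set of rational points. -/
def rationalPolytope {k : ℕ} (V : Finset (Fin k → ℚ)) : Set (Fin k → ℝ) :=
  convexHull ℝ ((fun (q : Fin k → ℚ) (i : Fin k) => (q i : ℝ)) '' (V : Set (Fin k → ℚ)))

/-- `P ⊆ [0,1]^k` is a rational polyhedron: as a subset of `ℝ^k` it is a finite union of rational
polytopes. -/
def IsRationalPolyhedron {k : ℕ} (P : Set (Fin k → unitInterval)) : Prop :=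
  ∃ W : Finset (Finset (Fin k → ℚ)),
    (fun (x : Fin k → unitInterval) (i : Fin k) => (x i : ℝ)) '' P = ⋃ V ∈ W, rationalPolytope V

/-- The congruence of `Free(k) / P` generated by the pairs `([a]_P, [b]_P)` with `(a, b) ∈ S`. -/
def inducedCon {k : ℕ} (P : Set (Fin k → unitInterval))
    (S : Set (FreeMV (Fin k) × FreeMV (Fin k))) : MVCon (FreeModPoly k P) :=
  MVCon.gen ((fun p => (polyClass P p.1, polyClass P p.2)) '' S)

/-! Part (2) is universal algebra. If A is Free(k) modulo the congruence generated by S, lift a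
finite generating set T of θ along a section; S together with the lifted pairs generates the kernel
of Free(k) → A → A/θ.

Part (1) reduces to θ_{P∩Q} ⊆ θ_P ∨ θ_Q, the reverse inclusion being clear. If a = b on P ∩ Q, then
w = a ⊙ ¬b, which is max(0, a − b), vanishes there. Suppose w ≤ u + v with u zero on P and v zero on
Q. Modulo the join, a = a ∧ (b ⊕ u ⊕ v) = a ∧ (b ⊕ u) = a ∧ b, and symmetrically b = b ∧ a.

The existence of u and v (`exists_evalAt_le_add`) is an error bound. P ∩ Q is a finite union of
cells given by joint systems T ∪ T' of rational inequalities. Since w is piecewise affine, Farkas'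
lemma on each piece of the cube bounds w by n times the total violation of T ∪ T'
(`eventually_evalAt_le`), hence by n times the violation of T plus n times that of T'. Conversely,
an integral affine form truncated to [0,1] is a term function, and rational forms become integral by
clearing denominators. So some term vanishes on P and, at each point, either equals 1 or dominates n
times the violation of a cell of P (`exists_polyhedron_barrier`). Such terms for P and Q serve as u
and v. -/

open Filter Finset

/-! ### Universal algebra: congruences, their images, finite presentations. -/

section UniversalAlgebra

variable {A : Type u} {B : Type v} [MVAlgebra A] [MVAlgebra B]

namespace MVCon

theorem cls_eq_iff (θ : MVCon A) {a b : A} : θ.cls a = θ.cls b ↔ θ.r a b :=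
  ⟨fun h => Quotient.exact h, fun h => Quotient.sound (s := Setoid.mk θ.r θ.iseqv) h⟩

theorem cls_surjective (θ : MVCon A) : Function.Surjective θ.cls := by
  rintro ⟨a⟩
  exact ⟨a, rfl⟩

/-- The quotient homomorphism. -/
def mkHom (θ : MVCon A) : MVHom A θ.Quot where
  toFun := θ.cls
  map_oplus _ _ := rfl
  map_neg _ := rfl
  map_bot := rfl

/-- The inverse image of a congruence under a homomorphism. -/
def comap (h : MVHom A B) (ψ : MVCon B) : MVCon A where
  r a b := ψ.r (h.toFun a) (h.toFun b)
  iseqv := ⟨fun _ => ψ.iseqv.refl _, fun e => ψ.iseqv.symm e, fun e e' => ψ.iseqv.trans e e'⟩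
  oplus e e' := by
    simp only [h.map_oplus]
    exact ψ.oplus e e'
  neg e := by
    simp only [h.map_neg]
    exact ψ.neg e

/-- The image, under a surjective homomorphism, of a congruence containing the kernel. -/
def mapOfSurjective (h : MVHom A B) (hs : Function.Surjective h.toFun) (ψ : MVCon A)
    (hk : ∀ a b, h.toFun a = h.toFun b → ψ.r a b) : MVCon B where
  r x y := ∃ a b, h.toFun a = x ∧ h.toFun b = y ∧ ψ.r a b
  iseqv := by
    refine ⟨fun x => ?_, ?_, ?_⟩
    · obtain ⟨a, rfl⟩ := hs x
      exact ⟨a, a, rfl, rfl, ψ.iseqv.refl a⟩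
    · rintro x y ⟨a, b, ha, hb, e⟩
      exact ⟨b, a, hb, ha, ψ.iseqv.symm e⟩
    · rintro x y z ⟨a, b, ha, hb, e⟩ ⟨b', c, hb', hc, e'⟩
      exact ⟨a, c, ha, hc, ψ.iseqv.trans e (ψ.iseqv.trans (hk b b' (hb.trans hb'.symm)) e')⟩
  oplus := by
    rintro _ _ _ _ ⟨a, b, rfl, rfl, e⟩ ⟨c, d, rfl, rfl, e'⟩
    exact ⟨_, _, h.map_oplus _ _, h.map_oplus _ _, ψ.oplus e e'⟩
  neg := by
    rintro _ _ ⟨a, b, rfl, rfl, e⟩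
    exact ⟨_, _, h.map_neg _, h.map_neg _, ψ.neg e⟩

/-- A generated congruence is an intersection of congruences, so information is extracted from it by
testing against a well-chosen one. On a quotient, that one is pushed forward from above and read off
here. -/
theorem mapOfSurjective_r_iff (h : MVHom A B) (hs : Function.Surjective h.toFun) (ψ : MVCon A)
    (hk : ∀ a b, h.toFun a = h.toFun b → ψ.r a b) (a b : A) :
    (mapOfSurjective h hs ψ hk).r (h.toFun a) (h.toFun b) ↔ ψ.r a b := by
  constructor
  · rintro ⟨a', b', ha, hb, e⟩
    exact ψ.iseqv.trans (hk _ _ ha.symm) (ψ.iseqv.trans e (hk _ _ hb))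
  · exact fun e => ⟨a, b, rfl, rfl, e⟩

theorem gen_of_mem {S : Set (A × A)} {p : A × A} (hp : p ∈ S) : (gen S).r p.1 p.2 :=
  fun _ hψ => hψ p hp

end MVCon

/-- Composition of homomorphisms. -/
def MVHom.comp {C : Type*} [MVAlgebra C] (g : MVHom B C) (f : MVHom A B) : MVHom A C where
  toFun := g.toFun ∘ f.toFun
  map_oplus x y := by simp [f.map_oplus, g.map_oplus]
  map_neg x := by simp [f.map_neg, g.map_neg]
  map_bot := by simp [f.map_bot, g.map_bot]

/-- The inverse isomorphism. -/
def MVEquiv.symm (e : MVEquiv A B) : MVEquiv B A where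
  toEquiv := e.toEquiv.symm
  map_oplus x y := e.toEquiv.injective <| by
    refine Eq.trans ?_ (e.map_oplus _ _).symm
    exact (e.toEquiv.apply_symm_apply _).trans
      (congrArg₂ _ (e.toEquiv.apply_symm_apply x).symm (e.toEquiv.apply_symm_apply y).symm)
  map_neg x := e.toEquiv.injective <| by
    refine Eq.trans ?_ (e.map_neg _).symm
    exact (e.toEquiv.apply_symm_apply _).trans
      (congrArg _ (e.toEquiv.apply_symm_apply x).symm)
  map_bot := e.toEquiv.injective <| (e.toEquiv.apply_symm_apply _).trans e.map_bot.symm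

/-- An isomorphism as a homomorphism. -/
def MVEquiv.toHom (e : MVEquiv A B) : MVHom A B where
  toFun := e.toFun
  map_oplus := e.map_oplus
  map_neg := e.map_neg
  map_bot := e.map_bot

/-- The first isomorphism theorem. -/
theorem MVCon.exists_equiv_of_surjective (h : MVHom A B) (hs : Function.Surjective h.toFun)
    (θ : MVCon A) (hθ : ∀ a b, θ.r a b ↔ h.toFun a = h.toFun b) :
    ∃ e : MVEquiv θ.Quot B, ∀ a, e.toEquiv (θ.cls a) = h.toFun a := by
  let f : θ.Quot → B := Quotient.lift h.toFun fun a b e => (hθ a b).1 e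
  have hf : Function.Bijective f := by
    constructor
    · rintro ⟨a⟩ ⟨b⟩ e
      exact θ.cls_eq_iff.2 ((hθ a b).2 e)
    · intro b
      obtain ⟨a, rfl⟩ := hs b
      exact ⟨θ.cls a, rfl⟩
  refine ⟨{ toEquiv := Equiv.ofBijective f hf, map_oplus := ?_, map_neg := ?_, map_bot := ?_ },
    fun a => rfl⟩
  · rintro ⟨a⟩ ⟨b⟩
    exact h.map_oplus a b
  · rintro ⟨a⟩
    exact h.map_neg a
  · exact h.map_bot

/-- A quotient of a finitely presented MV-algebra by a finitely generated congruence is finitely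
presented. -/
theorem IsFinitelyPresentedMV.quot (hA : IsFinitelyPresentedMV A) (θ : MVCon A) (hθ : θ.IsFG) :
    IsFinitelyPresentedMV θ.Quot := by
  obtain ⟨k, ψ, ⟨S, hS, rfl⟩, ⟨e⟩⟩ := hA
  obtain ⟨T, hT, rfl⟩ := hθ
  let g : MVHom (FreeMV (Fin k)) A := e.symm.toHom.comp (MVCon.gen S).mkHom
  have hg : Function.Surjective g.toFun :=
    e.toEquiv.symm.surjective.comp (MVCon.cls_surjective _)
  have hker : ∀ a b, g.toFun a = g.toFun b ↔ (MVCon.gen S).r a b := fun a b =>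
    e.toEquiv.symm.injective.eq_iff.trans (MVCon.cls_eq_iff _)
  obtain ⟨s, hs⟩ := hg.hasRightInverse
  -- S accounts for the kernel of `g`; the pairs of T are lifted by the section `s`.
  let U : Set (FreeMV (Fin k) × FreeMV (Fin k)) := S ∪ (fun p => (s p.1, s p.2)) '' T
  refine ⟨k, MVCon.gen U, ⟨U, hS.union (hT.image _), rfl⟩, ?_⟩
  obtain ⟨e', -⟩ := MVCon.exists_equiv_of_surjective ((MVCon.gen T).mkHom.comp g)
    ((MVCon.cls_surjective _).comp hg) (MVCon.gen U) (by
      intro a b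
      refine Iff.trans ?_ (MVCon.cls_eq_iff _).symm
      constructor
      · intro h
        refine h (MVCon.comap g (MVCon.gen T)) ?_
        rintro p (hp | ⟨q, hq, rfl⟩)
        · change (MVCon.gen T).r (g.toFun p.1) (g.toFun p.2)
          rw [(hker _ _).2 (MVCon.gen_of_mem hp)]
          exact (MVCon.gen T).iseqv.refl _
        · change (MVCon.gen T).r (g.toFun (s q.1)) (g.toFun (s q.2))
          rw [hs, hs]
          exact MVCon.gen_of_mem hq
      · intro h
        -- The kernel of `g` lies in `gen U` because S ⊆ U, so `gen U` descends to A, where it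
        -- contains T.
        have hk : ∀ a b, g.toFun a = g.toFun b → (MVCon.gen U).r a b := fun a b hab χ hχ =>
          (hker a b).1 hab χ fun p hp => hχ p (Or.inl hp)
        refine (MVCon.mapOfSurjective_r_iff g hg (MVCon.gen U) hk a b).1 (h _ fun p hp => ?_)
        rw [← hs p.1, ← hs p.2, MVCon.mapOfSurjective_r_iff]
        exact MVCon.gen_of_mem (show (s p.1, s p.2) ∈ U from Or.inr ⟨p, hp, rfl⟩))
  exact ⟨e'.symm⟩

end UniversalAlgebra

/-! ### Rational cones: Fourier-Motzkin elimination and Farkas' lemma. -/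

section Cones

variable {ι : Type*}

/-- `y` is a combination with nonnegative real coefficients of the rational vectors in `V`. -/
def InRatCone (V : Finset (ι → ℚ)) (y : ι → ℝ) : Prop :=
  ∃ c : (ι → ℚ) → ℝ, (∀ v, 0 ≤ c v) ∧ ∀ i, y i = ∑ v ∈ V, c v * v i

/-- Isolates the coefficient of one generator, so that adding a generator to a cone amounts to
eliminating one real parameter `t`. -/
theorem inRatCone_insert [DecidableEq (ι → ℚ)] {V : Finset (ι → ℚ)} {v : ι → ℚ} (hv : v ∉ V)
    (y : ι → ℝ) :
    InRatCone (insert v V) y ↔ ∃ t : ℝ, 0 ≤ t ∧ InRatCone V (fun i => y i - t * v i) := by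
  constructor
  · rintro ⟨c, hc, h⟩
    refine ⟨c v, hc v, c, hc, fun i => ?_⟩
    simp only [h, Finset.sum_insert hv]
    ring
  · rintro ⟨t, ht, c, hc, h⟩
    refine ⟨Function.update c v t, fun w => ?_, fun i => ?_⟩
    · by_cases e : w = v
      · subst e; simpa using ht
      · simpa [e] using hc w
    · rw [Finset.sum_insert hv, Function.update_self, ← sub_eq_iff_eq_add']
      refine (h i).trans ?_
      refine Finset.sum_congr rfl fun w hw => ?_
      rw [Function.update_of_ne (ne_of_mem_of_not_mem hw hv)]

variable [Fintype ι]

/-- The value at a real vector of the linear form with rational coefficients `f`. -/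
def ratForm (f : ι → ℚ) (y : ι → ℝ) : ℝ := ∑ i, (f i : ℝ) * y i

theorem ratForm_add (f g : ι → ℚ) (y : ι → ℝ) :
    ratForm (f + g) y = ratForm f y + ratForm g y := by
  simp [ratForm, add_mul, Finset.sum_add_distrib]

theorem ratForm_neg (f : ι → ℚ) (y : ι → ℝ) : ratForm (-f) y = -ratForm f y := by
  simp [ratForm]

theorem ratForm_sub (f g : ι → ℚ) (y : ι → ℝ) :
    ratForm (f - g) y = ratForm f y - ratForm g y := by
  rw [sub_eq_add_neg, ratForm_add, ratForm_neg, sub_eq_add_neg]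

theorem ratForm_smul (c : ℚ) (f : ι → ℚ) (y : ι → ℝ) :
    ratForm (c • f) y = c * ratForm f y := by
  simp [ratForm, Finset.mul_sum, mul_assoc]

theorem ratForm_sub_smul_right (f : ι → ℚ) (y z : ι → ℝ) (t : ℝ) :
    ratForm f (fun i => y i - t * z i) = ratForm f y - t * ratForm f z := by
  simp only [ratForm, Finset.mul_sum, ← Finset.sum_sub_distrib]
  exact Finset.sum_congr rfl fun i _ => by ring

theorem ratForm_cast_comm (f g : ι → ℚ) :
    ratForm f (fun i => (g i : ℝ)) = ratForm g (fun i => (f i : ℝ)) :=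
  Finset.sum_congr rfl fun _ _ => mul_comm _ _

theorem ratForm_single [DecidableEq ι] (i : ι) (y : ι → ℝ) : ratForm (Pi.single i 1) y = y i := by
  rw [ratForm, Finset.sum_eq_single i] <;> simp +contextual

theorem ratForm_cast (f v : ι → ℚ) :
    ratForm f (fun i => (v i : ℝ)) = ((∑ i, f i * v i : ℚ) : ℝ) := by
  simp [ratForm]

theorem InRatCone.ratForm_eq {V : Finset (ι → ℚ)} {y : ι → ℝ} {c : (ι → ℚ) → ℝ}
    (h : ∀ i, y i = ∑ v ∈ V, c v * v i) (z : ι → ℝ) :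
    ∑ i, y i * z i = ∑ v ∈ V, c v * ratForm v z := by
  simp only [h, ratForm, Finset.sum_mul, Finset.mul_sum]
  rw [Finset.sum_comm]
  exact Finset.sum_congr rfl fun v _ => Finset.sum_congr rfl fun i _ => by ring

theorem inRatCone_of_mem {V : Finset (ι → ℚ)} {v : ι → ℚ} (hv : v ∈ V) :
    InRatCone V (fun i => (v i : ℝ)) := by
  classical
  refine ⟨Pi.single v 1, fun w => ?_, fun i => ?_⟩
  · by_cases h : w = v
    · subst h; simp
    · simp [h]
  · simp [Pi.single_apply, hv]

/-- One step of Fourier-Motzkin elimination. -/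
theorem exists_finset_elim (X : Finset (ι → ℚ)) (v : ι → ℚ) :
    ∃ X' : Finset (ι → ℚ), ∀ y : ι → ℝ, (∀ f ∈ X', 0 ≤ ratForm f y) ↔
      ∃ t : ℝ, 0 ≤ t ∧ ∀ f ∈ X, 0 ≤ ratForm f y - t * ratForm f (fun i => (v i : ℝ)) := by
  classical
  let d : (ι → ℚ) → ℚ := fun f => ∑ i, f i * v i
  have hd : ∀ f : ι → ℚ, ratForm f (fun i => (v i : ℝ)) = (d f : ℝ) := fun f => ratForm_cast f v
  -- Forms with `d f > 0` bound `t` above, those with `d f < 0` bound it below. Pairing the lower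
  -- bound 0 with the upper bounds, and keeping the constraints free of `t`, gives the first set;
  -- pairing the other lower bounds with the upper ones gives the second.
  refine ⟨X.filter (fun f => 0 ≤ d f) ∪
    ((X.filter fun f => 0 < d f) ×ˢ (X.filter fun f => d f < 0)).image
      (fun p => d p.1 • p.2 - d p.2 • p.1), fun y => ?_⟩
  simp only [hd]
  constructor
  · intro H
    have H1 : ∀ f ∈ X, 0 ≤ d f → 0 ≤ ratForm f y := fun f hf h =>
      H f (Finset.mem_union_left _ (Finset.mem_filter.2 ⟨hf, h⟩))
    have H2 : ∀ f ∈ X, ∀ g ∈ X, 0 < d f → d g < 0 →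
        0 ≤ (d f : ℝ) * ratForm g y - (d g : ℝ) * ratForm f y := by
      intro f hf g hg h h'
      have := H (d f • g - d g • f) (Finset.mem_union_right _ (Finset.mem_image.2
        ⟨(f, g), by simp [hf, hg, h, h'], rfl⟩))
      rwa [ratForm_sub, ratForm_smul, ratForm_smul] at this
    -- The parameter is taken to be the largest lower bound, with 0 included for `0 ≤ t`.
    let L : Finset ℝ := insert 0 ((X.filter fun f => d f < 0).image fun g => ratForm g y / d g)
    obtain ⟨t, htL, ht⟩ := L.exists_max_image id ⟨0, Finset.mem_insert_self _ _⟩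
    simp only [id] at ht
    refine ⟨t, ht 0 (Finset.mem_insert_self _ _), fun f hf => ?_⟩
    rcases lt_trichotomy (d f) 0 with h | h | h
    · have h' : (d f : ℝ) < 0 := by exact_mod_cast h
      have := ht (ratForm f y / d f) (Finset.mem_insert_of_mem
        (Finset.mem_image.2 ⟨f, Finset.mem_filter.2 ⟨hf, h⟩, rfl⟩))
      rw [div_le_iff_of_neg h'] at this
      linarith
    · simpa [h] using H1 f hf h.ge
    · have h' : (0 : ℝ) < d f := by exact_mod_cast h
      rcases Finset.mem_insert.1 htL with e | e
      · simpa [e] using H1 f hf h.le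
      · obtain ⟨g, hg, rfl⟩ := Finset.mem_image.1 e
        obtain ⟨hg, hgn⟩ := Finset.mem_filter.1 hg
        have hg' : (d g : ℝ) < 0 := by exact_mod_cast hgn
        have := H2 f hf g hg h hgn
        rw [sub_nonneg, div_mul_eq_mul_div, div_le_iff_of_neg hg']
        linarith
  · rintro ⟨t, ht, H⟩ f hf
    rcases Finset.mem_union.1 hf with h | h
    · obtain ⟨h, h0⟩ := Finset.mem_filter.1 h
      have h0' : (0 : ℝ) ≤ d f := by exact_mod_cast h0
      have := H f h
      have := mul_nonneg ht h0'
      linarith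
    · obtain ⟨⟨p, q⟩, hpq, rfl⟩ := Finset.mem_image.1 h
      simp only [Finset.mem_product, Finset.mem_filter] at hpq
      obtain ⟨⟨hp, hp0⟩, hq, hq0⟩ := hpq
      have hp0' : (0 : ℝ) < d p := by exact_mod_cast hp0
      have hq0' : (d q : ℝ) < 0 := by exact_mod_cast hq0
      rw [ratForm_sub, ratForm_smul, ratForm_smul]
      have h1 := mul_nonneg hp0'.le (H q hq)
      have h2 := mul_nonneg (neg_pos.2 hq0').le (H p hp)
      nlinarith

/-- A finitely generated rational cone is cut out by finitely many rational inequalities. -/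
theorem exists_finset_inRatCone_iff (V : Finset (ι → ℚ)) :
    ∃ X : Finset (ι → ℚ), ∀ y : ι → ℝ, InRatCone V y ↔ ∀ f ∈ X, 0 ≤ ratForm f y := by
  classical
  induction V using Finset.induction_on with
  | empty =>
    refine ⟨Finset.univ.image (fun i => Pi.single i 1) ∪
      Finset.univ.image (fun i => -Pi.single i 1), fun y => ?_⟩
    constructor
    · rintro ⟨c, -, h⟩ f -
      have : ∀ i, y i = 0 := by simpa using h
      simp [ratForm, this]
    · intro H
      refine ⟨0, fun _ => le_rfl, fun i => ?_⟩
      have h1 := H (Pi.single i 1) (by simp)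
      have h2 := H (-Pi.single i 1) (by simp)
      rw [ratForm_neg, ratForm_single] at h2
      rw [ratForm_single] at h1
      simp only [Finset.sum_empty]
      linarith
  | insert v V hv ih =>
    obtain ⟨X, hX⟩ := ih
    obtain ⟨X', hX'⟩ := exists_finset_elim X v
    refine ⟨X', fun y => ?_⟩
    rw [inRatCone_insert hv, hX']
    simp only [hX, ratForm_sub_smul_right]

/-- Farkas' lemma for rational linear forms. -/
theorem inRatCone_of_forall_nonneg (T : Finset (ι → ℚ)) (h : ι → ℚ)
    (H : ∀ y : ι → ℝ, (∀ f ∈ T, 0 ≤ ratForm f y) → 0 ≤ ratForm h y) :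
    InRatCone T (fun i => (h i : ℝ)) := by
  obtain ⟨X, hX⟩ := exists_finset_inRatCone_iff T
  refine (hX _).2 fun x hx => ?_
  rw [ratForm_cast_comm]
  -- Duality: a form `x` defining the cone, read as a vector, is nonnegative against every generator
  -- in `T`, so it is an admissible `y`.
  refine H _ fun f hf => ?_
  rw [ratForm_cast_comm]
  exact (hX _).1 (inRatCone_of_mem hf) x hx

end Cones

/-! ### Rational polytopes and an error bound on the unit cube. -/

section AffineForms

variable {k : ℕ}

/-- The value at `x` of the affine form whose coefficients are `f`, the constant term being
`f none`. -/
def affForm (f : Option (Fin k) → ℚ) (x : Fin k → ℝ) : ℝ :=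
  ratForm f (fun o => o.elim 1 x)

theorem affForm_eq (f : Option (Fin k) → ℚ) (x : Fin k → ℝ) :
    affForm f x = f none + ∑ i, (f (some i) : ℝ) * x i := by
  simp [affForm, ratForm, Fintype.sum_option]

theorem affForm_combo (f : Option (Fin k) → ℚ) {x y : Fin k → ℝ} {a b : ℝ} (hab : a + b = 1) :
    affForm f (a • x + b • y) = a * affForm f x + b * affForm f y := by
  simp only [affForm_eq, Pi.add_apply, Pi.smul_apply, smul_eq_mul, mul_add, Finset.mul_sum,
    Finset.sum_add_distrib]
  have : (f none : ℝ) = a * f none + b * f none := by rw [← add_mul, hab, one_mul]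
  have e1 : ∑ i, (f (some i) : ℝ) * (a * x i) = ∑ i, a * ((f (some i) : ℝ) * x i) :=
    Finset.sum_congr rfl fun i _ => by ring
  have e2 : ∑ i, (f (some i) : ℝ) * (b * y i) = ∑ i, b * ((f (some i) : ℝ) * y i) :=
    Finset.sum_congr rfl fun i _ => by ring
  rw [e1, e2]
  linarith

/-- A rational polytope is cut out by finitely many rational affine inequalities. -/
theorem exists_finset_mem_rationalPolytope_iff (V : Finset (Fin k → ℚ)) :
    ∃ T : Finset (Option (Fin k) → ℚ), ∀ x, x ∈ rationalPolytope V ↔ ∀ f ∈ T, 0 ≤ affForm f x := by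
  classical
  -- Homogenization: vertices are lifted to height 1, so the coordinate `none` later says that the
  -- coefficients sum to 1.
  let h : (Fin k → ℚ) → Option (Fin k) → ℚ := fun v o => o.elim 1 v
  have hinj : Function.Injective h := fun v w e => funext fun i => congrFun e (some i)
  obtain ⟨T, hT⟩ := exists_finset_inRatCone_iff (V.image h)
  refine ⟨T, fun x => ⟨fun hx => ?_, fun hx => ?_⟩⟩
  · have hconv : Convex ℝ {x : Fin k → ℝ | ∀ f ∈ T, 0 ≤ affForm f x} := by
      intro x hx y hy a b ha hb hab f hf
      rw [affForm_combo f hab]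
      exact add_nonneg (mul_nonneg ha (hx f hf)) (mul_nonneg hb (hy f hf))
    refine convexHull_min ?_ hconv hx
    rintro _ ⟨v, hv, rfl⟩
    have := (hT _).1 (inRatCone_of_mem (Finset.mem_image_of_mem h hv))
    intro f hf
    convert this f hf using 1
    rw [affForm]
    congr 1
    funext o
    cases o <;> simp [h]
  · obtain ⟨c, hc, e⟩ := (hT _).2 hx
    simp only [Finset.sum_image hinj.injOn] at e
    have e0 : ∑ v ∈ V, c (h v) = 1 := by simpa [h] using (e none).symm
    have e1 : x = ∑ v ∈ V, c (h v) • (fun i => (v i : ℝ)) := by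
      funext i
      simpa [h] using e (some i)
    rw [e1]
    exact (convex_convexHull ℝ _).sum_mem (fun v _ => hc _) e0
      fun v hv => subset_convexHull ℝ _ ⟨v, hv, rfl⟩

theorem IsRationalPolyhedron.exists_finset {P : Set (Fin k → unitInterval)}
    (hP : IsRationalPolyhedron P) :
    ∃ W : Finset (Finset (Option (Fin k) → ℚ)), ∀ x : Fin k → unitInterval,
      x ∈ P ↔ ∃ T ∈ W, ∀ f ∈ T, 0 ≤ affForm f (fun i => (x i : ℝ)) := by
  classical
  obtain ⟨W, hW⟩ := hP
  choose T hT using exists_finset_mem_rationalPolytope_iff (k := k)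
  refine ⟨W.image T, fun x => ?_⟩
  have hinj : Function.Injective
      (fun (x : Fin k → unitInterval) (i : Fin k) => (x i : ℝ)) :=
    fun x y e => funext fun i => Subtype.ext (congrFun e i)
  rw [← hinj.mem_set_image, hW]
  simp [hT]

/-- A form that is nonnegative on the part of the unit cube cut out by `T` and `C` is bounded
below, on the part cut out by `C`, by a multiple of the violation of `T`. -/
theorem exists_nat_neg_affForm_le (T C : Finset (Option (Fin k) → ℚ)) (h : Option (Fin k) → ℚ)
    (H : ∀ x : Fin k → unitInterval, (∀ f ∈ T, 0 ≤ affForm f (fun i => (x i : ℝ))) →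
      (∀ f ∈ C, 0 ≤ affForm f (fun i => (x i : ℝ))) → 0 ≤ affForm h (fun i => (x i : ℝ))) :
    ∃ N : ℕ, ∀ x : Fin k → unitInterval, (∀ f ∈ C, 0 ≤ affForm f (fun i => (x i : ℝ))) →
      -affForm h (fun i => (x i : ℝ)) ≤ N * ∑ f ∈ T, max 0 (-affForm f (fun i => (x i : ℝ))) := by
  classical
  let e : Option (Fin k) → Option (Fin k) → ℚ := fun o => Pi.single o 1
  -- Together these forms cut out the cone over the cube: height at least 0, each coordinate between
  -- 0 and the height.
  let D : Finset (Option (Fin k) → ℚ) := insert (e none)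
    (Finset.univ.image (fun i => e (some i)) ∪ Finset.univ.image (fun i => e none - e (some i)))
  have he : ∀ o y, ratForm (e o) y = y o := fun o y => ratForm_single o y
  have hD : ∀ x : Fin k → unitInterval, ∀ f ∈ D, 0 ≤ affForm f (fun i => (x i : ℝ)) := by
    intro x f hf
    simp only [D, Finset.mem_insert, Finset.mem_union, Finset.mem_image, Finset.mem_univ,
      true_and] at hf
    rcases hf with rfl | ⟨i, rfl⟩ | ⟨i, rfl⟩
    · simp [affForm, he]
    · simpa [affForm, he] using (x i).2.1
    · simpa [affForm, ratForm_sub, he] using (x i).2.2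
  have key : InRatCone (T ∪ (C ∪ D)) (fun i => (h i : ℝ)) := by
    refine inRatCone_of_forall_nonneg _ _ fun y hy => ?_
    have hyD : ∀ f ∈ D, 0 ≤ ratForm f y := fun f hf =>
      hy f (Finset.mem_union_right _ (Finset.mem_union_right _ hf))
    have h0 : 0 ≤ y none := by simpa [he] using hyD (e none) (by simp [D])
    have h1 : ∀ i, 0 ≤ y (some i) := fun i => by
      simpa [he] using hyD (e (some i)) (by simp [D])
    have h2 : ∀ i, y (some i) ≤ y none := fun i => by
      simpa [ratForm_sub, he] using hyD (e none - e (some i)) (by simp [D])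
    -- At height 0 the cube bounds force y = 0, so there are no directions at infinity; at positive
    -- height y rescales to a point of the cube. Hence an infeasible system needs no separate
    -- treatment.
    rcases h0.eq_or_lt with h0 | h0
    · have : ∀ o, y o = 0 := by
        rintro (_ | i)
        · exact h0.symm
        · exact le_antisymm (h0 ▸ h2 i) (h1 i)
      simp [ratForm, this]
    · let x : Fin k → unitInterval := fun i =>
        ⟨y (some i) / y none, div_nonneg (h1 i) h0.le, (div_le_one h0).2 (h2 i)⟩
      have hx : ∀ f, ratForm f y = y none * affForm f (fun i => (x i : ℝ)) := by
        intro f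
        rw [affForm, ratForm, ratForm, Finset.mul_sum]
        refine Finset.sum_congr rfl fun o _ => ?_
        cases o with
        | none => simp [mul_comm]
        | some i =>
          simp only [x, Option.elim_some]
          field_simp
      have hpos : ∀ f ∈ T ∪ (C ∪ D), 0 ≤ affForm f (fun i => (x i : ℝ)) := fun f hf =>
        (mul_nonneg_iff_of_pos_left h0).1 (hx f ▸ hy f hf)
      rw [hx]
      exact mul_nonneg h0.le (H x (fun f hf => hpos f (by simp [hf]))
        (fun f hf => hpos f (by simp [hf])))
  obtain ⟨c, hc, hsum⟩ := key
  -- Where `C` holds, only forms in `T` can be negative; `N` bounds each of their Farkas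
  -- multipliers.
  obtain ⟨N, hN⟩ := exists_nat_ge (∑ f ∈ T, c f)
  refine ⟨N, fun x hx => ?_⟩
  have hval := InRatCone.ratForm_eq hsum (fun o => o.elim 1 (fun i => (x i : ℝ)))
  change affForm h _ = _ at hval
  have hsub : T ⊆ T ∪ (C ∪ D) := Finset.subset_union_left
  rw [hval, ← Finset.sum_sdiff hsub, neg_add, Finset.mul_sum]
  have n1 : 0 ≤ ∑ f ∈ (T ∪ (C ∪ D)) \ T,
      c f * ratForm f (fun o => o.elim 1 (fun i => (x i : ℝ))) := by
    refine Finset.sum_nonneg fun f hf => mul_nonneg (hc f) ?_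
    have hf' : f ∈ C ∨ f ∈ D := by
      simp only [Finset.mem_sdiff, Finset.mem_union] at hf
      tauto
    exact hf'.elim (hx f) (hD x f)
  have n2 : -∑ f ∈ T, c f * ratForm f (fun o => o.elim 1 (fun i => (x i : ℝ))) ≤
      ∑ f ∈ T, (N : ℝ) * max 0 (-affForm f (fun i => (x i : ℝ))) := by
    rw [← Finset.sum_neg_distrib]
    refine Finset.sum_le_sum fun f hf => ?_
    have hcN : c f ≤ N := (Finset.single_le_sum (fun g _ => hc g) hf).trans hN
    calc _ = c f * (-affForm f (fun i => (x i : ℝ))) := by rw [affForm]; ring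
      _ ≤ c f * max 0 (-affForm f (fun i => (x i : ℝ))) :=
        mul_le_mul_of_nonneg_left (le_max_right _ _) (hc f)
      _ ≤ _ := mul_le_mul_of_nonneg_right hcN (le_max_left _ _)
  linarith

end AffineForms

/-! ### Term functions and their affine pieces. -/

section TermFunctions

open MVAlgebra

variable {k : ℕ}

theorem coe_evalAt_oplus (a b : FreeMV (Fin k)) (x : Fin k → unitInterval) :
    (evalAt (oplus a b) x : ℝ) = min 1 (evalAt a x + evalAt b x : ℝ) :=
  congrArg Subtype.val ((FreeMV.lift x).map_oplus a b)

theorem coe_evalAt_neg (a : FreeMV (Fin k)) (x : Fin k → unitInterval) :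
    (evalAt (neg a) x : ℝ) = 1 - evalAt a x :=
  congrArg Subtype.val ((FreeMV.lift x).map_neg a)

theorem coe_evalAt_bot (x : Fin k → unitInterval) :
    (evalAt (bot : FreeMV (Fin k)) x : ℝ) = 0 :=
  congrArg Subtype.val (FreeMV.lift x).map_bot

theorem evalAt_of (i : Fin k) (x : Fin k → unitInterval) : evalAt (FreeMV.of i) x = x i := rfl

/-- The strong conjunction `a ⊙ b`. -/
def MVAlgebra.odot {A : Type*} [MVAlgebra A] (a b : A) : A := neg (oplus (neg a) (neg b))

/-- The lattice meet `a ⊙ (a → b)`. -/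
def MVAlgebra.meet {A : Type*} [MVAlgebra A] (a b : A) : A := odot a (imp a b)

theorem coe_evalAt_odot (a b : FreeMV (Fin k)) (x : Fin k → unitInterval) :
    (evalAt (odot a b) x : ℝ) = max 0 (evalAt a x + evalAt b x - 1 : ℝ) := by
  rw [odot, coe_evalAt_neg, coe_evalAt_oplus, coe_evalAt_neg, coe_evalAt_neg]
  grind

theorem coe_evalAt_meet (a b : FreeMV (Fin k)) (x : Fin k → unitInterval) :
    (evalAt (meet a b) x : ℝ) = min (evalAt a x : ℝ) (evalAt b x) := by
  rw [meet, coe_evalAt_odot, imp, coe_evalAt_oplus, coe_evalAt_neg]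
  have h0 := (evalAt a x).2.1
  have h1 := (evalAt b x).2.1
  grind

/-- Term functions are piecewise affine with rational pieces. -/
theorem exists_finset_pieces (a : FreeMV (Fin k)) :
    ∃ R : Finset (Finset (Option (Fin k) → ℚ) × (Option (Fin k) → ℚ)),
      ∀ x : Fin k → unitInterval,
        (∃ r ∈ R, ∀ f ∈ r.1, 0 ≤ affForm f (fun i => (x i : ℝ))) ∧
        ∀ r ∈ R, (∀ f ∈ r.1, 0 ≤ affForm f (fun i => (x i : ℝ))) →
          (evalAt a x : ℝ) = affForm r.2 (fun i => (x i : ℝ)) := by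
  classical
  have h1 : ∀ y : Fin k → ℝ, affForm (Pi.single none 1) y = 1 := fun y =>
    ratForm_single _ _
  obtain ⟨s⟩ := a
  change ∃ R : Finset (Finset (Option (Fin k) → ℚ) × (Option (Fin k) → ℚ)), ∀ x, _ ∧
    ∀ r ∈ R, _ → (evalAt (FreeMV.mk s) x : ℝ) = _
  induction s with
  | var j =>
    refine ⟨{(∅, Pi.single (some j) 1)}, fun x => ⟨by simp, ?_⟩⟩
    simp only [Finset.mem_singleton, forall_eq]
    intro _
    exact (ratForm_single (some j) (fun o : Option (Fin k) => o.elim 1 fun i => (x i : ℝ))).symm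
  | bot =>
    refine ⟨{(∅, 0)}, fun x => ⟨by simp, ?_⟩⟩
    simp only [Finset.mem_singleton, forall_eq]
    intro _
    refine (coe_evalAt_bot x).trans ?_
    simp [affForm, ratForm]
  | neg s ih =>
    obtain ⟨R, hR⟩ := ih
    refine ⟨R.image fun r => (r.1, Pi.single none 1 - r.2), fun x => ⟨?_, ?_⟩⟩
    · obtain ⟨r, hr, h⟩ := (hR x).1
      exact ⟨_, Finset.mem_image_of_mem _ hr, h⟩
    · intro q hq h
      obtain ⟨r, hr, rfl⟩ := Finset.mem_image.1 hq
      refine (coe_evalAt_neg (FreeMV.mk s) x).trans ?_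
      have e := h1 (fun i => (x i : ℝ))
      rw [(hR x).2 _ hr h]
      simp only [affForm, ratForm_sub] at e ⊢
      rw [e]
  | oplus s t ih ih' =>
    obtain ⟨R, hR⟩ := ih
    obtain ⟨R', hR'⟩ := ih'
    -- Truncation splits each pair of pieces in two: sum at most 1, keeping the sum, and sum at
    -- least 1, with constant value 1. The two formulas agree on the overlap.
    refine ⟨(R ×ˢ R').image (fun p => (insert (Pi.single none 1 - (p.1.2 + p.2.2))
        (p.1.1 ∪ p.2.1), p.1.2 + p.2.2)) ∪
      (R ×ˢ R').image (fun p => (insert (p.1.2 + p.2.2 - Pi.single none 1)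
        (p.1.1 ∪ p.2.1), Pi.single none 1)), fun x => ⟨?_, ?_⟩⟩
    · obtain ⟨r, hr, h⟩ := (hR x).1
      obtain ⟨r', hr', h'⟩ := (hR' x).1
      have hu : ∀ f ∈ r.1 ∪ r'.1, 0 ≤ affForm f (fun i => (x i : ℝ)) := fun f hf =>
        (Finset.mem_union.1 hf).elim (h f) (h' f)
      have hmem : (r, r') ∈ R ×ˢ R' := Finset.mem_product.2 ⟨hr, hr'⟩
      rcases le_total 0 (affForm (Pi.single none 1 - (r.2 + r'.2)) (fun i => (x i : ℝ)))
        with hle | hle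
      · refine ⟨_, Finset.mem_union_left _ (Finset.mem_image_of_mem _ hmem), ?_⟩
        exact (Finset.forall_mem_insert _ _ _).2 ⟨hle, hu⟩
      · refine ⟨_, Finset.mem_union_right _ (Finset.mem_image_of_mem _ hmem), ?_⟩
        refine (Finset.forall_mem_insert _ _ _).2 ⟨?_, hu⟩
        simp only [affForm, ratForm_sub] at hle ⊢
        linarith
    · intro q hq h
      refine (coe_evalAt_oplus (FreeMV.mk s) (FreeMV.mk t) x).trans ?_
      have e := h1 (fun i => (x i : ℝ))
      rcases Finset.mem_union.1 hq with hq | hq <;>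
      · obtain ⟨⟨r, r'⟩, hp, rfl⟩ := Finset.mem_image.1 hq
        obtain ⟨hr, hr'⟩ := Finset.mem_product.1 hp
        obtain ⟨hle, hu⟩ := (Finset.forall_mem_insert _ _ _).1 h
        have hu1 := fun f hf => hu f (Finset.mem_union_left _ hf)
        have hu2 := fun f hf => hu f (Finset.mem_union_right _ hf)
        rw [(hR x).2 r hr hu1, (hR' x).2 r' hr' hu2]
        simp only [affForm, ratForm_sub, ratForm_add] at e hle ⊢
        rw [e] at hle
        first
        | exact min_eq_right (by linarith)
        | rw [e]; exact min_eq_left (by linarith)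

/-! ### Truncated integral affine forms as term functions. -/

/-- The function `h`, shifted by any integer and truncated to `[0,1]`, is a term function. -/
def ClipRepresentable (h : (Fin k → unitInterval) → ℝ) : Prop :=
  ∀ b : ℤ, ∃ a : FreeMV (Fin k), ∀ x, (evalAt a x : ℝ) = max 0 (min 1 (h x + b))

theorem ClipRepresentable.zero : ClipRepresentable (k := k) (fun _ => 0) := by
  intro b
  rcases le_or_gt b 0 with h | h
  · refine ⟨bot, fun x => ?_⟩
    have : (b : ℝ) ≤ 0 := by exact_mod_cast h
    rw [coe_evalAt_bot]
    grind
  · refine ⟨neg bot, fun x => ?_⟩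
    have : (1 : ℝ) ≤ b := by exact_mod_cast h
    rw [coe_evalAt_neg, coe_evalAt_bot]
    grind

theorem ClipRepresentable.neg {h : (Fin k → unitInterval) → ℝ} (H : ClipRepresentable h) :
    ClipRepresentable (fun x => -h x) := by
  intro b
  obtain ⟨a, ha⟩ := H (1 - b)
  refine ⟨MVAlgebra.neg a, fun x => ?_⟩
  rw [coe_evalAt_neg, ha]
  push_cast
  grind

/-- Writing clip for truncation to [0,1], clip(t + x) = (clip t ⊕ x) ⊙ clip(t + 1) for x in [0,1].
The shift by 1 is why representability is demanded for all integer translates at once. -/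
theorem ClipRepresentable.add_coord {h : (Fin k → unitInterval) → ℝ} (H : ClipRepresentable h)
    (i : Fin k) : ClipRepresentable (fun x => h x + x i) := by
  intro b
  obtain ⟨a, ha⟩ := H b
  obtain ⟨a', ha'⟩ := H (b + 1)
  refine ⟨odot (oplus a (FreeMV.of i)) a', fun x => ?_⟩
  rw [coe_evalAt_odot, coe_evalAt_oplus, ha, ha', evalAt_of]
  have h0 := (x i).2.1
  have h1 := (x i).2.2
  push_cast
  grind

theorem ClipRepresentable.add_nat_mul_coord {h : (Fin k → unitInterval) → ℝ}
    (H : ClipRepresentable h) (i : Fin k) (n : ℕ) :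
    ClipRepresentable (fun x => h x + n * x i) := by
  induction n with
  | zero => simpa using H
  | succ n ih =>
    convert ih.add_coord i using 2
    push_cast
    ring

theorem ClipRepresentable.add_int_mul_coord {h : (Fin k → unitInterval) → ℝ}
    (H : ClipRepresentable h) (i : Fin k) (n : ℤ) :
    ClipRepresentable (fun x => h x + n * x i) := by
  obtain ⟨m, rfl | rfl⟩ := n.eq_nat_or_neg
  · simpa using H.add_nat_mul_coord i m
  -- Subtraction is addition between two negations: h − m x = −(−h + m x).
  · convert (H.neg.add_nat_mul_coord i m).neg using 2
    push_cast
    ring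

theorem clipRepresentable_sum (c : Fin k → ℤ) (s : Finset (Fin k)) :
    ClipRepresentable (fun x => ∑ i ∈ s, (c i : ℝ) * x i) := by
  classical
  induction s using Finset.induction_on with
  | empty => simpa using ClipRepresentable.zero
  | insert i s hi ih =>
    convert ih.add_int_mul_coord i (c i) using 2
    rw [Finset.sum_insert hi, add_comm]

/-- A rational affine form becomes integral after multiplication by a positive integer. -/
theorem exists_nat_mul_affForm (f : Option (Fin k) → ℚ) :
    ∃ (m : ℕ) (c : Option (Fin k) → ℤ), 0 < m ∧
      ∀ x, m * affForm f x = c none + ∑ i, (c (some i) : ℝ) * x i := by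
  let m : ℕ := ∏ o, (f o).den
  have hm : 0 < m := Finset.prod_pos fun o _ => (f o).den_pos
  have hc : ∀ o, ∃ z : ℤ, (m : ℝ) * f o = z := by
    intro o
    obtain ⟨q, hq⟩ : (f o).den ∣ m := Finset.dvd_prod_of_mem _ (Finset.mem_univ o)
    refine ⟨q * (f o).num, ?_⟩
    have : (f o : ℝ) * (f o).den = (f o).num := by exact_mod_cast Rat.mul_den_eq_num (f o)
    rw [hq]
    push_cast
    rw [← this]
    ring
  choose c hc using hc
  refine ⟨m, c, hm, fun x => ?_⟩
  rw [affForm_eq, mul_add, hc, Finset.mul_sum]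
  simp only [← mul_assoc, hc]

/-! ### Barrier terms for half-spaces, polytopes and polyhedra. -/

/-- A term function vanishing on a rational half-space and growing steeply outside it. -/
theorem exists_halfSpace_barrier (f : Option (Fin k) → ℚ) (n : ℕ) :
    ∃ a : FreeMV (Fin k), ∀ x : Fin k → unitInterval,
      (0 ≤ affForm f (fun i => (x i : ℝ)) → (evalAt a x : ℝ) = 0) ∧
      min 1 (n * max 0 (-affForm f (fun i => (x i : ℝ)))) ≤ evalAt a x := by
  obtain ⟨m, c, hm, hc⟩ := exists_nat_mul_affForm f
  -- The term is the truncation of −n·m·f, where `m` clears denominators; `m ≥ 1` only makes it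
  -- steeper.
  obtain ⟨a, ha⟩ := clipRepresentable_sum (fun i => -(n * c (some i))) Finset.univ (-(n * c none))
  refine ⟨a, fun x => ?_⟩
  have e : (evalAt a x : ℝ) = max 0 (min 1 (-(n * (m * affForm f (fun i => (x i : ℝ)))))) := by
    rw [ha, hc, mul_add, Finset.mul_sum]
    push_cast
    simp only [neg_mul, Finset.sum_neg_distrib, mul_assoc]
    congr 2
    ring
  have hn : (0 : ℝ) ≤ n := Nat.cast_nonneg n
  have hm' : (1 : ℝ) ≤ m := by exact_mod_cast hm
  rw [e]
  constructor
  · intro h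
    have : 0 ≤ (n : ℝ) * (m * affForm f (fun i => (x i : ℝ))) := by positivity
    grind
  · rcases le_total 0 (affForm f (fun i => (x i : ℝ))) with h | h
    · rw [max_eq_left (neg_nonpos.2 h), mul_zero]
      exact (min_le_right _ _).trans (le_max_left _ _)
    · rw [max_eq_right (neg_nonneg.2 h)]
      refine (min_le_min le_rfl ?_).trans (le_max_right _ _)
      rw [← mul_neg, ← mul_neg]
      exact mul_le_mul_of_nonneg_left (le_mul_of_one_le_left (neg_nonneg.2 h) hm') hn

/-- A term function vanishing on a rational polytope and growing steeply outside it. -/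
theorem exists_polytope_barrier (T : Finset (Option (Fin k) → ℚ)) (n : ℕ) :
    ∃ a : FreeMV (Fin k), ∀ x : Fin k → unitInterval,
      ((∀ f ∈ T, 0 ≤ affForm f (fun i => (x i : ℝ))) → (evalAt a x : ℝ) = 0) ∧
      min 1 (n * ∑ f ∈ T, max 0 (-affForm f (fun i => (x i : ℝ)))) ≤ evalAt a x := by
  classical
  induction T using Finset.induction_on with
  | empty => exact ⟨bot, fun x => by simp [coe_evalAt_bot]⟩
  | insert f T hf ih =>
    obtain ⟨a, ha⟩ := ih
    obtain ⟨b, hb⟩ := exists_halfSpace_barrier f n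
    refine ⟨oplus b a, fun x => ⟨fun h => ?_, ?_⟩⟩
    · obtain ⟨h, h'⟩ := (Finset.forall_mem_insert _ _ _).1 h
      rw [coe_evalAt_oplus, (ha x).1 h', (hb x).1 h]
      simp
    · rw [coe_evalAt_oplus, Finset.sum_insert hf, mul_add]
      have h1 := (ha x).2
      have h2 := (hb x).2
      have h3 := (evalAt a x).2.1
      have h4 := (evalAt b x).2.1
      grind

/-- A term function vanishing on a rational polyhedron and growing steeply outside it. -/
theorem exists_polyhedron_barrier (W : Finset (Finset (Option (Fin k) → ℚ))) (n : ℕ) :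
    ∃ a : FreeMV (Fin k), ∀ x : Fin k → unitInterval,
      ((∃ T ∈ W, ∀ f ∈ T, 0 ≤ affForm f (fun i => (x i : ℝ))) → (evalAt a x : ℝ) = 0) ∧
      ((evalAt a x : ℝ) = 1 ∨
        ∃ T ∈ W, n * ∑ f ∈ T, max 0 (-affForm f (fun i => (x i : ℝ))) ≤ evalAt a x) := by
  classical
  induction W using Finset.induction_on with
  -- With no cell available, only the alternative of value 1 remains.
  | empty => exact ⟨neg bot, fun x => by simp [coe_evalAt_neg, coe_evalAt_bot]⟩
  | insert T W hT ih =>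
    obtain ⟨a, ha⟩ := ih
    obtain ⟨b, hb⟩ := exists_polytope_barrier T n
    refine ⟨meet b a, fun x => ⟨fun h => ?_, ?_⟩⟩
    · rw [coe_evalAt_meet]
      rcases (Finset.exists_mem_insert _ _ _).1 h with h | h
      · rw [(hb x).1 h]
        exact min_eq_left (evalAt a x).2.1
      · rw [(ha x).1 h]
        exact min_eq_right (evalAt b x).2.1
    · rw [coe_evalAt_meet]
      have h1 := (hb x).2
      have h2 := (evalAt a x).2.2
      have h3 := (evalAt b x).2.2
      rcases le_total (evalAt b x : ℝ) (evalAt a x) with h | h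
      · rw [min_eq_left h]
        rcases min_le_iff.1 h1 with h1 | h1
        · exact Or.inl (le_antisymm h3 h1)
        · exact Or.inr ⟨T, Finset.mem_insert_self _ _, h1⟩
      · rw [min_eq_right h]
        exact (ha x).2.imp_right fun ⟨T', hT', h'⟩ => ⟨T', Finset.mem_insert_of_mem hT', h'⟩

/-! ### Domination of a term function vanishing on an intersection. -/

/-- A term function vanishing where `T` holds is bounded by a multiple of the violation of `T`. -/
theorem eventually_evalAt_le (w : FreeMV (Fin k)) (T : Finset (Option (Fin k) → ℚ))
    (hw : ∀ x : Fin k → unitInterval, (∀ f ∈ T, 0 ≤ affForm f (fun i => (x i : ℝ))) →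
      (evalAt w x : ℝ) = 0) :
    ∀ᶠ n : ℕ in atTop, ∀ x : Fin k → unitInterval,
      (evalAt w x : ℝ) ≤ n * ∑ f ∈ T, max 0 (-affForm f (fun i => (x i : ℝ))) := by
  obtain ⟨R, hR⟩ := exists_finset_pieces w
  have key : ∀ r ∈ R, ∀ᶠ n : ℕ in atTop, ∀ x : Fin k → unitInterval,
      (∀ f ∈ r.1, 0 ≤ affForm f (fun i => (x i : ℝ))) →
      (evalAt w x : ℝ) ≤ n * ∑ f ∈ T, max 0 (-affForm f (fun i => (x i : ℝ))) := by
    intro r hr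
    -- On the piece, `-r.2` equals −w, hence is 0 wherever `T` also holds. Stating the bound for all
    -- large `n` lets the finitely many pieces share one constant.
    obtain ⟨N, hN⟩ := exists_nat_neg_affForm_le T r.1 (-r.2) (by
      intro x hT hC
      rw [affForm, ratForm_neg, ← affForm, ← (hR x).2 r hr hC, hw x hT, neg_zero])
    filter_upwards [eventually_ge_atTop N] with n hn x hx
    have h := hN x hx
    rw [affForm, ratForm_neg, ← affForm, ← (hR x).2 r hr hx, _root_.neg_neg] at h
    exact h.trans (mul_le_mul_of_nonneg_right (by exact_mod_cast hn)
      (Finset.sum_nonneg fun f _ => le_max_left _ _))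
  filter_upwards [(eventually_all_finset R).2 key] with n hn x
  obtain ⟨r, hr, hx⟩ := (hR x).1
  exact hn r hr x hx

/-- A term function vanishing on the intersection of two rational polyhedra is dominated by the
sum of term functions vanishing on the one and on the other. -/
theorem exists_evalAt_le_add {P Q : Set (Fin k → unitInterval)} (hP : IsRationalPolyhedron P)
    (hQ : IsRationalPolyhedron Q) (w : FreeMV (Fin k))
    (hw : ∀ x ∈ P ∩ Q, (evalAt w x : ℝ) = 0) :
    ∃ u v : FreeMV (Fin k), (∀ x ∈ P, (evalAt u x : ℝ) = 0) ∧ (∀ x ∈ Q, (evalAt v x : ℝ) = 0) ∧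
      ∀ x, (evalAt w x : ℝ) ≤ evalAt u x + evalAt v x := by
  classical
  obtain ⟨W, hW⟩ := hP.exists_finset
  obtain ⟨W', hW'⟩ := hQ.exists_finset
  have key : ∀ p ∈ W ×ˢ W', ∀ᶠ n : ℕ in atTop, ∀ x : Fin k → unitInterval,
      (evalAt w x : ℝ) ≤ n * ∑ f ∈ p.1 ∪ p.2, max 0 (-affForm f (fun i => (x i : ℝ))) := by
    intro p hp
    obtain ⟨hp1, hp2⟩ := Finset.mem_product.1 hp
    refine eventually_evalAt_le w _ fun x hx => hw x ⟨?_, ?_⟩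
    · exact (hW x).2 ⟨p.1, hp1, fun f hf => hx f (Finset.mem_union_left _ hf)⟩
    · exact (hW' x).2 ⟨p.2, hp2, fun f hf => hx f (Finset.mem_union_right _ hf)⟩
  obtain ⟨n, hn⟩ := ((eventually_all_finset _).2 key).exists
  obtain ⟨u, hu⟩ := exists_polyhedron_barrier W n
  obtain ⟨v, hv⟩ := exists_polyhedron_barrier W' n
  refine ⟨u, v, fun x hx => (hu x).1 ((hW x).1 hx), fun x hx => (hv x).1 ((hW' x).1 hx),
    fun x => ?_⟩
  have h0 := (evalAt u x).2.1
  have h1 := (evalAt v x).2.1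
  have h2 := (evalAt w x).2.2
  -- A barrier that has reached 1 dominates `w` by itself; otherwise each barrier singles out a
  -- cell.
  rcases (hu x).2 with e | ⟨T, hT, e⟩
  · rw [e]
    linarith
  rcases (hv x).2 with e' | ⟨T', hT', e'⟩
  · rw [e']
    linarith
  have h3 := hn (T, T') (Finset.mem_product.2 ⟨hT, hT'⟩) x
  have h4 : ∑ f ∈ T ∪ T', max 0 (-affForm f (fun i => (x i : ℝ))) ≤
      ∑ f ∈ T, max 0 (-affForm f (fun i => (x i : ℝ))) +
      ∑ f ∈ T', max 0 (-affForm f (fun i => (x i : ℝ))) := by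
    rw [← Finset.sum_union_inter]
    exact le_add_of_nonneg_right (Finset.sum_nonneg fun f _ => le_max_left _ _)
  have h5 := mul_le_mul_of_nonneg_left h4 (Nat.cast_nonneg n : (0 : ℝ) ≤ n)
  rw [mul_add] at h5
  linarith

/-! ### The congruence of an intersection. -/

theorem polyCon_r_iff (P : Set (Fin k → unitInterval)) (a b : FreeMV (Fin k)) :
    (polyCon P).r a b ↔ ∀ x ∈ P, (evalAt a x : ℝ) = evalAt b x :=
  (polyFilter_iff P a b).trans (forall₂_congr fun _ _ => Subtype.ext_iff)

theorem rel_meet_of_polyCon_le {P Q : Set (Fin k → unitInterval)} (hP : IsRationalPolyhedron P)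
    (hQ : IsRationalPolyhedron Q) (ψ : MVCon (FreeMV (Fin k)))
    (hψP : ∀ a b, (polyCon P).r a b → ψ.r a b) (hψQ : ∀ a b, (polyCon Q).r a b → ψ.r a b)
    {a b : FreeMV (Fin k)} (hab : (polyCon (P ∩ Q)).r a b) : ψ.r a (meet a b) := by
  rw [polyCon_r_iff] at hab
  obtain ⟨u, v, hu, hv, huv⟩ := exists_evalAt_le_add hP hQ (odot a (neg b)) (by
    intro x hx
    rw [coe_evalAt_odot, coe_evalAt_neg, hab x hx]
    simp)
  -- This identity of functions holds on the whole cube. Passing through θ_P turns it into a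
  -- relation in Free(k) without the completeness theorem.
  have h1 : ψ.r a (meet a (oplus (oplus b u) v)) := by
    refine hψP _ _ ((polyCon_r_iff _ _ _).2 fun x _ => ?_)
    have h := huv x
    have := (evalAt a x).2.2
    have := (evalAt v x).2.1
    rw [coe_evalAt_odot, coe_evalAt_neg] at h
    rw [coe_evalAt_meet, coe_evalAt_oplus, coe_evalAt_oplus]
    grind
  -- Modulo θ_Q the summand `v` is 0; in the next step `u` is 0 modulo θ_P.
  have h2 : ψ.r (meet a (oplus (oplus b u) v)) (meet a (oplus b u)) := by
    refine hψQ _ _ ((polyCon_r_iff _ _ _).2 fun x hx => ?_)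
    rw [coe_evalAt_meet, coe_evalAt_meet, coe_evalAt_oplus, hv x hx, add_zero,
      min_eq_right (evalAt (oplus b u) x).2.2]
  have h3 : ψ.r (meet a (oplus b u)) (meet a b) := by
    refine hψP _ _ ((polyCon_r_iff _ _ _).2 fun x hx => ?_)
    rw [coe_evalAt_meet, coe_evalAt_meet, coe_evalAt_oplus, hu x hx, add_zero,
      min_eq_right (evalAt b x).2.2]
  exact ψ.iseqv.trans h1 (ψ.iseqv.trans h2 h3)

/-- The congruence of `P ∩ Q` is contained in every congruence containing those of `P` and `Q`. -/
theorem rel_of_polyCon_inter {P Q : Set (Fin k → unitInterval)} (hP : IsRationalPolyhedron P)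
    (hQ : IsRationalPolyhedron Q) (ψ : MVCon (FreeMV (Fin k)))
    (hψP : ∀ a b, (polyCon P).r a b → ψ.r a b) (hψQ : ∀ a b, (polyCon Q).r a b → ψ.r a b)
    {a b : FreeMV (Fin k)} (hab : (polyCon (P ∩ Q)).r a b) : ψ.r a b := by
  have h1 := rel_meet_of_polyCon_le hP hQ ψ hψP hψQ hab
  have h2 := rel_meet_of_polyCon_le hP hQ ψ hψP hψQ ((polyCon (P ∩ Q)).iseqv.symm hab)
  have h3 : ψ.r (meet a b) (meet b a) := hψP _ _ ((polyCon_r_iff _ _ _).2 fun x _ => by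
    rw [coe_evalAt_meet, coe_evalAt_meet, min_comm])
  exact ψ.iseqv.trans h1 (ψ.iseqv.trans h3 (ψ.iseqv.symm h2))

theorem polyCon_mono {P Q : Set (Fin k → unitInterval)} (h : P ⊆ Q) {a b : FreeMV (Fin k)}
    (hab : (polyCon Q).r a b) : (polyCon P).r a b := by
  rw [polyCon_r_iff] at hab ⊢
  exact fun x hx => hab x (h hx)

/-- One direction tests the induced congruence against the image of θ_{P∩Q} in Free(k)/P. For the
other, any congruence containing the generators pulls back to one containing θ_P, as the kernel, and
θ_Q, since `S` generates it. -/
theorem inducedCon_r_iff {P Q : Set (Fin k → unitInterval)} (hP : IsRationalPolyhedron P)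
    (hQ : IsRationalPolyhedron Q) {S : Set (FreeMV (Fin k) × FreeMV (Fin k))}
    (hS : MVCon.gen S = polyCon Q) (a b : FreeMV (Fin k)) :
    (inducedCon P S).r (polyClass P a) (polyClass P b) ↔ (polyCon (P ∩ Q)).r a b := by
  constructor
  · intro h
    have hk : ∀ a b, (polyCon P).cls a = (polyCon P).cls b → (polyCon (P ∩ Q)).r a b :=
      fun a b e => polyCon_mono Set.inter_subset_left ((polyCon P).cls_eq_iff.1 e)
    refine (MVCon.mapOfSurjective_r_iff (polyCon P).mkHom (polyCon P).cls_surjective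
      (polyCon (P ∩ Q)) hk a b).1 (h _ ?_)
    rintro _ ⟨p, hp, rfl⟩
    refine (MVCon.mapOfSurjective_r_iff (polyCon P).mkHom (polyCon P).cls_surjective
      (polyCon (P ∩ Q)) hk p.1 p.2).2 (polyCon_mono Set.inter_subset_right ?_)
    rw [← hS]
    exact MVCon.gen_of_mem hp
  · intro h ψ hψ
    refine rel_of_polyCon_inter hP hQ (MVCon.comap (polyCon P).mkHom ψ) ?_ ?_ h
    · intro a b hab
      have e : polyClass P a = polyClass P b := (polyCon P).cls_eq_iff.2 hab
      change ψ.r (polyClass P a) (polyClass P b)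
      rw [e]
      exact ψ.iseqv.refl _
    · intro a b hab
      rw [← hS] at hab
      exact hab _ fun p hp => hψ _ ⟨p, hp, rfl⟩

/-- The quotient homomorphism `Free(k) / Q → Free(k) / P` for `P ⊆ Q`. -/
def polyQuotHom {P Q : Set (Fin k → unitInterval)} (h : P ⊆ Q) :
    MVHom (FreeModPoly k Q) (FreeModPoly k P) where
  toFun := Quotient.lift (polyClass P) fun _ _ hab =>
    (polyCon P).cls_eq_iff.2 (polyCon_mono h hab)
  map_oplus := by
    rintro ⟨a⟩ ⟨b⟩
    rfl
  map_neg := by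
    rintro ⟨a⟩
    rfl
  map_bot := rfl

end TermFunctions

theorem mainTheorem11 :
    (∀ (k : ℕ) (P Q : Set (Fin k → unitInterval)),
      IsRationalPolyhedron P → IsRationalPolyhedron Q →
      ∀ S : Set (FreeMV (Fin k) × FreeMV (Fin k)), MVCon.gen S = polyCon Q →
        ∃ e : MVEquiv (inducedCon P S).Quot (FreeModPoly k (P ∩ Q)),
          ∀ a : FreeMV (Fin k),
            e.toEquiv ((inducedCon P S).cls (polyClass P a)) = polyClass (P ∩ Q) a) ∧
    (∀ (A : Type*) [MVAlgebra A], IsFinitelyPresentedMV A →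
      ∀ θ : MVCon A, θ.IsFG → IsFinitelyPresentedMV θ.Quot) := by
  refine ⟨fun k P Q hP hQ S hS => ?_, fun A _ hA θ hθ => hA.quot θ hθ⟩
  obtain ⟨e, he⟩ := MVCon.exists_equiv_of_surjective
    (polyQuotHom (Set.inter_subset_left : P ∩ Q ⊆ P))
    (fun y => by
      obtain ⟨a, rfl⟩ := (polyCon (P ∩ Q)).cls_surjective y
      exact ⟨polyClass P a, rfl⟩)
    (inducedCon P S) (by
      rintro ⟨a⟩ ⟨b⟩
      exact (inducedCon_r_iff hP hQ hS a b).trans (polyCon (P ∩ Q)).cls_eq_iff.symm)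
  exact ⟨e, fun a => he _⟩
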